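/- Consider a slotted system with users $1,\dots,N$, a non-empty subset $\mathcal S\subseteq\{1,\dots,N\}$, and one machine, which at any time is free, internally busy, or executing a job of some user. At the beginning of each slot in which the machine is not executing a user's job, the server samples the state of the machine with probability $\bar\mu\in(0,1]$; if it samples the machine and finds it free, a job of the scheduled user is assigned to the machine at once. Under the max-age policy the scheduled user is a user of $\mathcal S$ whose age is maximal among the users of $\mathcal S$. At the end of a slot in which the machine executes a job of user $i$, the job is completed with probability $q_i\in(0,1]$, and upon completion the machine becomes internally busy with probability $s\in(0,1]$ and free with probability $1-s$; at the end of any other slot the machine switches between free and internally busy with probability $q\in(0,1]$. All these random choices are independent. The age $v_k(t)$ of user $k$ in slot $t$ is the time elapsed since the last slot before $t$ in which a job of user $k$ was completed. The initial state of the system is arbitrary (with deterministic initial ages $\ge 1$). Assume that the job queues of all users in $\mathcal S$ are non-empty throughout. Then for every $k\in\mathcal S$ the average age $\Delta_k=\limsup_{T\to\infty}\frac1T\sum_{t=1}^T\mathbb E[v_k(t)]$ is $$\Delta_k=\frac{|\mathcal S|\,(\beta_2-\beta_1^2)+\sum_{i\in\mathcal S}\frac{1-q_i}{q_i^2}}{2\left(|\mathcal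 S|\,\beta_1+\sum_{i\in\mathcal S}\frac{1-q_i}{q_i}\right)}+\frac12\left(|\mathcal S|\,\beta_1+\sum_{i\in\mathcal S}\frac{1-q_i}{q_i}+1\right),$$ where $$\beta_1=\frac1{\bar\mu}\left((1-\bar\mu)+s\frac{\bar\mu}{q}+1\right),\qquad \beta_2=\frac{2}{\bar\mu^2}\Big(s\,\alpha^2+(1-\bar\mu)\big(\alpha-s-\bar\mu(1-s)+3\big)\Big)+\beta_1,\qquad \alpha=1-\bar\mu+\frac{\bar\mu}{q}.$$ -/

import Mathlib

open MeasureTheory ProbabilityTheory Filter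
open scoped ENNReal

namespace JobAge

/-- State of the machine: internally busy, free, or executing an external job of a user. -/
inductive Machine (N : ℕ) : Type
  | busy : Machine N
  | free : Machine N
  | ext (i : Fin N) : Machine N

/-- The random coins tossed in each slot: the server's sampling coin, the coin of the free/busy
chain, the coin choosing the state after a job completion, and the service coin of each user. -/
inductive Coin (N : ℕ) : Type
  | sample : Coin N
  | flip : Coin N
  | release : Coin N
  | service (i : Fin N) : Coin N

/-- Success probabilities of the coins: sampling probability `μ`, free/busy transition
probability `q`, probability `s` of becoming internally busy after a completion, and service
rates `r i`. -/
def Coin.prob {N : ℕ} (μ s q : ℝ) (r : Fin N → ℝ) : Coin N → ℝ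
  | .sample => μ
  | .flip => q
  | .release => s
  | .service i => r i

/-- State of the system at the beginning of a slot, before the server acts. Queue lengths may be
infinite, so that a user may start with an inexhaustible backlog. -/
structure State (N : ℕ) : Type where
  machine : Machine N
  age : Fin N → ℕ
  queue : Fin N → ℕ∞

/-- A max-age scheduling rule on `S`: it picks a user of `S` whose age is maximal among the users
of `S` (with some rule for breaking ties). -/
def IsMaxAge {N : ℕ} (S : Finset (Fin N)) (sel : (Fin N → ℕ) → Fin N) : Prop :=
  ∀ v, sel v ∈ S ∧ ∀ i ∈ S, v i ≤ v (sel v)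

/-- Beginning of a slot: the machine after the action of the server. If the machine is free and is
sampled, a job of the scheduled user is assigned to it, provided that there is one. A machine that
is not free, or is not sampled, is left as it is. -/
noncomputable def assign {N : ℕ} (sel : (Fin N → ℕ) → Fin N) (sampled : Bool) (x : State N) :
    Machine N :=
  open Classical in
  match x.machine with
  | .busy => .busy
  | .free => if sampled = true ∧ x.queue (sel x.age) ≠ 0 then .ext (sel x.age) else .free
  | .ext i => .ext i

/-- The job of user `i` is completed in a slot in which the coins are `c` and the machine is `m`
after the action of the server. -/
def Completes {N : ℕ} (c : Coin N → Bool) (m : Machine N) (i : Fin N) : Prop :=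
  m = .ext i ∧ c (.service i) = true

/-- End of a slot: the transition of the machine. -/
def nextMachine {N : ℕ} (c : Coin N → Bool) : Machine N → Machine N
  | .busy => if c .flip then .free else .busy
  | .free => if c .flip then .busy else .free
  | .ext i => if c (.service i) then (if c .release then .busy else .free) else .ext i

/-- One slot with coins `c` and arrivals `a`. -/
noncomputable def step {N : ℕ} (sel : (Fin N → ℕ) → Fin N) (c : Coin N → Bool) (a : Fin N → ℕ)
    (x : State N) : State N :=
  open Classical in
  { machine := nextMachine c (assign sel (c .sample) x)
    age := fun i => if Completes c (assign sel (c .sample) x) i then 1 else x.age i + 1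
    queue := fun i =>
      x.queue i - (if Completes c (assign sel (c .sample) x) i then 1 else 0) + (a i : ℕ∞) }

/-- The state at the beginning of slot `t`; the first slot is slot `0`, with state `x₀`. -/
noncomputable def path {Ω : Type*} {N : ℕ} (sel : (Fin N → ℕ) → Fin N)
    (ξ : ℕ → Coin N → Ω → Bool) (a : ℕ → Fin N → Ω → ℕ) (x₀ : State N) : ℕ → Ω → State N
  | 0, _ => x₀
  | t + 1, ω => step sel (fun c => ξ t c ω) (fun i => a t i ω) (path sel ξ a x₀ t ω)

/-- The event that a job of user `i` is completed in slot `t`. -/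
def CompletesAt {Ω : Type*} {N : ℕ} (sel : (Fin N → ℕ) → Fin N)
    (ξ : ℕ → Coin N → Ω → Bool) (a : ℕ → Fin N → Ω → ℕ) (x₀ : State N) (t : ℕ) (i : Fin N)
    (ω : Ω) : Prop :=
  Completes (fun c => ξ t c ω) (assign sel (ξ t .sample ω) (path sel ξ a x₀ t ω)) i

/-- The age in a slot is the time elapsed since the last slot in which a job was completed. -/
theorem age_eq_sub {Ω : Type*} {N : ℕ} (sel : (Fin N → ℕ) → Fin N)
    (ξ : ℕ → Coin N → Ω → Bool) (a : ℕ → Fin N → Ω → ℕ) (x₀ : State N) (i : Fin N) (ω : Ω)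
    (t t' : ℕ) (h : IsGreatest {u | u < t ∧ CompletesAt sel ξ a x₀ u i ω} t') :
    (path sel ξ a x₀ t ω).age i = t - t' := by
  induction t with
  | zero => exact absurd h.1.1 (Nat.not_lt_zero _)
  | succ t ih =>
    by_cases hc : CompletesAt sel ξ a x₀ t i ω
    · have h1 : t ≤ t' := h.2 ⟨Nat.lt_succ_self t, hc⟩
      have h2 : t' < t + 1 := h.1.1
      have h3 : (path sel ξ a x₀ (t + 1) ω).age i = 1 := if_pos hc
      omega
    · have h0 : t' ≠ t := fun e => hc (e ▸ h.1.2)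
      have h1 : t' < t + 1 := h.1.1
      have h2 := ih ⟨⟨by omega, h.1.2⟩, fun u hu => h.2 ⟨Nat.lt_succ_of_lt hu.1, hu.2⟩⟩
      have h3 : (path sel ξ a x₀ (t + 1) ω).age i = (path sel ξ a x₀ t ω).age i + 1 := if_neg hc
      omega

/-- Long-run average `limsup_T (1/T) ∑_t E[v_k(t)]`, over the first `T` slots, of the expected age
of user `k`. -/
noncomputable def avgAge {Ω : Type*} [MeasurableSpace Ω] (P : Measure Ω) {N : ℕ}
    (X : ℕ → Ω → State N) (k : Fin N) : ℝ≥0∞ :=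
  limsup (fun T : ℕ => (∑ t ∈ Finset.range T, ∫⁻ ω, ((X t ω).age k : ℝ≥0∞) ∂P) / (T : ℝ≥0∞)) atTop

/-- `α = 1 - μ + μ / q`. -/
noncomputable def alpha (μ q : ℝ) : ℝ := 1 - μ + μ / q

/-- `β₁ = (1/μ) ((1 - μ) + s μ / q + 1)`. -/
noncomputable def beta1 (μ s q : ℝ) : ℝ := 1 / μ * ((1 - μ) + s * (μ / q) + 1)

/-- `β₂ = (2/μ²) (s α² + (1 - μ) (α - s - μ (1 - s) + 3)) + β₁`. -/
noncomputable def beta2 (μ s q : ℝ) : ℝ :=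
  2 / μ ^ 2 * (s * alpha μ q ^ 2 + (1 - μ) * (alpha μ q - s - μ * (1 - s) + 3)) + beta1 μ s q

end JobAge

/-! ### The chain of configurations and its transition operator. -/

namespace JobAge

/-! With backlogged queues the machine and the ages form a Markov chain of their own. Suppose that
no other user of `S` has the age of `k`. Unless a job of `k` is already running, each user of `S`
older than `k` is served exactly once before the next completion for `k`, because a served user
becomes younger than `k`. The time to that completion is a sum of independent waits and services, so
the expected sum of `age + θ` until then depends only on the mean and variance of this time; this is
`potential`. For `θ = -Δ`, with `Δ` chosen so that a full cycle between two completions for `k`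
costs zero (`cost_cycle`), it solves the Poisson equation `K h = h - age + Δ` (`kernel_potential`).
Summation over time then telescopes.

Ties with `k` can only stem from the initial ages. There the order of service depends on the
tie-breaking rule and only an inequality survives (`kernel_le_potential`). With `θ = 1` it is a
Lyapunov estimate: the expected age stays bounded, and the expected age accumulated in tied slots is
finite. The defect in the Poisson equation is therefore summable, and the accumulated expected age
is `T Δ + O(1)` (`exists_abs_sum_expect_sub_le`). `lintegral_configPath` identifies the expectations
with powers of the transition operator. -/

/-- The part of the state that evolves autonomously when the queues never empty: the machine and
the ages. -/
abbrev Config (N : ℕ) : Type := Machine N × (Fin N → ℕ)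

/-- Ages after a slot without completion. -/
def adv {N : ℕ} (v : Fin N → ℕ) : Fin N → ℕ := fun i => v i + 1

/-- Ages after a slot in which a job of user `i` is completed. -/
def reset {N : ℕ} (i : Fin N) (v : Fin N → ℕ) : Fin N → ℕ := fun j => if j = i then 1 else v j + 1

/-- The parameters of the system. -/
structure Rates (N : ℕ) : Type where
  μ : ℝ
  s : ℝ
  q : ℝ
  r : Fin N → ℝ
  μ_pos : 0 < μ
  μ_le : μ ≤ 1
  s_pos : 0 < s
  s_le : s ≤ 1
  q_pos : 0 < q
  q_le : q ≤ 1
  r_pos : ∀ i, 0 < r i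
  r_le : ∀ i, r i ≤ 1

namespace Rates

variable {N : ℕ} (R : Rates N)

/-- Expected value of `F` after a slot in which the machine executes a job of user `i`. -/
def serve (F : Config N → ℝ) (i : Fin N) (v : Fin N → ℕ) : ℝ :=
  (1 - R.r i) * F (.ext i, adv v)
    + R.r i * (R.s * F (.busy, reset i v) + (1 - R.s) * F (.free, reset i v))

/-- Transition operator of the chain of configurations. -/
def kernel (sel : (Fin N → ℕ) → Fin N) (F : Config N → ℝ) : Config N → ℝ
  | (.busy, v) => R.q * F (.free, adv v) + (1 - R.q) * F (.busy, adv v)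
  | (.free, v) => (1 - R.μ) * (R.q * F (.busy, adv v) + (1 - R.q) * F (.free, adv v))
      + R.μ * R.serve F (sel v) v
  | (.ext i, v) => R.serve F i v

theorem serve_mono {F G : Config N → ℝ} {i : Fin N} {v : Fin N → ℕ}
    (h1 : F (.ext i, adv v) ≤ G (.ext i, adv v)) (h2 : ∀ m, F (m, reset i v) ≤ G (m, reset i v)) :
    R.serve F i v ≤ R.serve G i v := by
  have a1 := R.r_pos i
  have a2 := sub_nonneg.2 (R.r_le i)
  have a3 := R.s_pos
  have a4 := sub_nonneg.2 R.s_le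
  unfold serve
  gcongr <;> first | exact h1 | exact h2 _

theorem kernel_mono (sel : (Fin N → ℕ) → Fin N) {F G : Config N → ℝ} {v : Fin N → ℕ}
    (h1 : ∀ m, F (m, adv v) ≤ G (m, adv v)) (h2 : ∀ m i, F (m, reset i v) ≤ G (m, reset i v))
    (m : Machine N) : R.kernel sel F (m, v) ≤ R.kernel sel G (m, v) := by
  have a1 := R.q_pos
  have a2 := sub_nonneg.2 R.q_le
  have a3 := R.μ_pos
  have a4 := sub_nonneg.2 R.μ_le
  have hs : ∀ i, R.serve F i v ≤ R.serve G i v := fun i => R.serve_mono (h1 _) fun m => h2 m i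
  cases m with
  | busy => simp only [kernel]; gcongr <;> exact h1 _
  | free => simp only [kernel]; gcongr <;> first | exact h1 _ | exact hs _
  | ext i => exact hs i

theorem kernel_congr (sel : (Fin N → ℕ) → Fin N) {F G : Config N → ℝ} {v : Fin N → ℕ}
    (h1 : ∀ m, F (m, adv v) = G (m, adv v)) (h2 : ∀ m i, F (m, reset i v) = G (m, reset i v))
    (m : Machine N) : R.kernel sel F (m, v) = R.kernel sel G (m, v) :=
  le_antisymm (R.kernel_mono sel (fun m => (h1 m).le) (fun m i => (h2 m i).le) m)
    (R.kernel_mono sel (fun m => (h1 m).ge) (fun m i => (h2 m i).ge) m)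

theorem kernel_add (sel : (Fin N → ℕ) → Fin N) (F G : Config N → ℝ) :
    R.kernel sel (F + G) = R.kernel sel F + R.kernel sel G := by
  ext ⟨m, v⟩
  cases m <;> simp only [kernel, serve, Pi.add_apply] <;> ring

theorem kernel_smul (sel : (Fin N → ℕ) → Fin N) (c : ℝ) (F : Config N → ℝ) :
    R.kernel sel (c • F) = c • R.kernel sel F := by
  ext ⟨m, v⟩
  cases m <;> simp only [kernel, serve, Pi.smul_apply, smul_eq_mul] <;> ring

theorem kernel_const (sel : (Fin N → ℕ) → Fin N) (c : ℝ) :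
    R.kernel sel (fun _ => c) = fun _ => c := by
  ext ⟨m, v⟩
  cases m <;> simp only [kernel, serve] <;> ring

/-- The transition operator as a linear map. -/
def kernelₗ (sel : (Fin N → ℕ) → Fin N) : (Config N → ℝ) →ₗ[ℝ] (Config N → ℝ) where
  toFun := R.kernel sel
  map_add' := R.kernel_add sel
  map_smul' := R.kernel_smul sel

/-- Expectation in slot `t` of a function of the configuration, for the chain started in `x`. -/
def expect (sel : (Fin N → ℕ) → Fin N) (x : Config N) (t : ℕ) : (Config N → ℝ) →ₗ[ℝ] ℝ :=
  LinearMap.proj x ∘ₗ (R.kernelₗ sel ^ t)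

@[simp] theorem expect_zero (sel : (Fin N → ℕ) → Fin N) (x : Config N) (F : Config N → ℝ) :
    R.expect sel x 0 F = F x := rfl

theorem expect_succ (sel : (Fin N → ℕ) → Fin N) (x : Config N) (t : ℕ) (F : Config N → ℝ) :
    R.expect sel x (t + 1) F = R.expect sel x t (R.kernel sel F) := by
  simp [expect, pow_succ, kernelₗ]

theorem one_le_adv (v : Fin N → ℕ) (i : Fin N) : 1 ≤ adv v i := by simp [adv]

theorem one_le_reset (j : Fin N) (v : Fin N → ℕ) (i : Fin N) : 1 ≤ reset j v i := by
  unfold reset; split_ifs <;> omega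

/-- Ages at least 1 persist along the chain, so the comparison is needed only on such
configurations. -/
theorem expect_mono (sel : (Fin N → ℕ) → Fin N) {x : Config N} (hx : ∀ i, 1 ≤ x.2 i) (t : ℕ)
    {F G : Config N → ℝ} (h : ∀ m v, (∀ i, 1 ≤ v i) → F (m, v) ≤ G (m, v)) :
    R.expect sel x t F ≤ R.expect sel x t G := by
  induction t generalizing F G with
  | zero => exact h x.1 x.2 hx
  | succ t ih =>
    rw [expect_succ, expect_succ]
    exact ih fun m v _ => R.kernel_mono sel (fun m => h _ _ (one_le_adv v))
      (fun m i => h _ _ (one_le_reset i v)) m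

theorem expect_const (sel : (Fin N → ℕ) → Fin N) (x : Config N) (t : ℕ) (c : ℝ) :
    R.expect sel x t (fun _ => c) = c := by
  induction t with
  | zero => rfl
  | succ t ih => rw [expect_succ, kernel_const, ih]

/-! ### Moments of the phases and first-step equations for the cost. -/

/-- Mean of the waiting time until an assignment, from a free machine. -/
noncomputable def freeMean : ℝ := 2 * (1 - R.μ) / R.μ

/-- Variance of the waiting time until an assignment, from a free machine. -/
noncomputable def freeVar : ℝ := (1 - R.μ) / R.μ * (2 + 2 / R.q + 2 * R.freeMean)

/-- Mean of the waiting time until an assignment, after a completion. -/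
noncomputable def waitMean : ℝ := R.freeMean + R.s / R.q

/-- Variance of the waiting time until an assignment, after a completion. -/
noncomputable def waitVar : ℝ := R.freeVar + R.s * (2 - R.q - R.s) / R.q ^ 2

/-- Mean of the time from an assignment to the completion of a job of user `k` when the users in
`A` are served before `k`. -/
noncomputable def serveMean (k : Fin N) (A : Finset (Fin N)) : ℝ :=
  1 / R.r k + ∑ i ∈ A, (1 / R.r i + R.waitMean)

/-- Variance of the time from an assignment to the completion of a job of user `k` when the users
in `A` are served before `k`. -/
noncomputable def serveVar (k : Fin N) (A : Finset (Fin N)) : ℝ :=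
  (1 - R.r k) / R.r k ^ 2 + ∑ i ∈ A, ((1 - R.r i) / R.r i ^ 2 + R.waitVar)

/-- Mean of the time to the next completion of a job of user `k`. -/
noncomputable def remMean (k : Fin N) (A : Finset (Fin N)) : Machine N → ℝ
  | .busy => 1 / R.q + (R.freeMean + R.serveMean k A)
  | .free => R.freeMean + R.serveMean k A
  | .ext i => if i = k then R.serveMean k ∅ else R.serveMean k (insert i A)

/-- Variance of the time to the next completion of a job of user `k`. -/
noncomputable def remVar (k : Fin N) (A : Finset (Fin N)) : Machine N → ℝ
  | .busy => (1 - R.q) / R.q ^ 2 + (R.freeVar + R.serveVar k A)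
  | .free => R.freeVar + R.serveVar k A
  | .ext i => if i = k then R.serveVar k ∅ else R.serveVar k (insert i A)

/-- The expectation of `∑ u < T, (v + u + θ)` for a random time `T` with mean `m` and variance
`V`. -/
noncomputable def cost (θ v m V : ℝ) : ℝ := v * m + (V + m ^ 2 - m) / 2 + θ * m

/-- First-step analysis of a geometric phase followed by an independent remainder. It survives
mixing because `cost` is affine in the first and second moments `m` and `V + m ^ 2`. -/
theorem cost_geometric {p : ℝ} (hp : p ≠ 0) (θ v m V : ℝ) :
    (1 - p) * cost θ (v + 1) (1 / p + m) ((1 - p) / p ^ 2 + V) + p * cost θ (v + 1) m V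
      = cost θ v (1 / p + m) ((1 - p) / p ^ 2 + V) - v - θ := by
  unfold cost
  field_simp
  ring

/-- With probability `s` a geometric busy period precedes the wait from a free machine; `waitMean`
and `waitVar` are the moments of this mixture. -/
theorem cost_wait (θ v m V : ℝ) :
    R.s * cost θ v (1 / R.q + (R.freeMean + m)) ((1 - R.q) / R.q ^ 2 + (R.freeVar + V))
      + (1 - R.s) * cost θ v (R.freeMean + m) (R.freeVar + V)
      = cost θ v (R.waitMean + m) (R.waitVar + V) := by
  have := R.q_pos.ne'
  unfold cost waitMean waitVar
  field_simp
  ring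

/-- First-step equation that determines `freeMean` and `freeVar`; for the mean `w` it reads `w = (1
- μ) (2 + w)`. An assignment consumes no slot, so the sampled branch enters through the one-slot
image `cost θ v m V - v - θ` of the cost from assignment. -/
theorem cost_free (θ v m V : ℝ) :
    (1 - R.μ) * (R.q * cost θ (v + 1) (1 / R.q + (R.freeMean + m))
        ((1 - R.q) / R.q ^ 2 + (R.freeVar + V))
      + (1 - R.q) * cost θ (v + 1) (R.freeMean + m) (R.freeVar + V))
      + R.μ * (cost θ v m V - v - θ)
      = cost θ v (R.freeMean + m) (R.freeVar + V) - v - θ := by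
  have := R.q_pos.ne'
  have := R.μ_pos.ne'
  unfold cost freeVar freeMean
  field_simp
  ring

theorem freeMean_nonneg : 0 ≤ R.freeMean := by
  have := R.μ_pos
  have := sub_nonneg.2 R.μ_le
  unfold freeMean; positivity

theorem freeVar_nonneg : 0 ≤ R.freeVar := by
  have := R.μ_pos
  have := R.q_pos
  have := sub_nonneg.2 R.μ_le
  have := R.freeMean_nonneg
  unfold freeVar; positivity

theorem waitMean_nonneg : 0 ≤ R.waitMean := by
  have := R.freeMean_nonneg
  have := R.s_pos
  have := R.q_pos
  unfold waitMean; positivity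

theorem waitVar_nonneg : 0 ≤ R.waitVar := by
  have := R.freeVar_nonneg
  have := R.s_pos
  have := R.q_pos
  have : 0 ≤ 2 - R.q - R.s := by linarith [R.q_le, R.s_le]
  unfold waitVar; positivity

theorem one_le_inv_r (i : Fin N) : 1 ≤ 1 / R.r i := by
  rw [le_div_iff₀ (R.r_pos i)]; linarith [R.r_le i]

theorem serviceVar_nonneg (i : Fin N) : 0 ≤ (1 - R.r i) / R.r i ^ 2 :=
  div_nonneg (sub_nonneg.2 (R.r_le i)) (sq_nonneg _)

theorem serveMean_mono (k : Fin N) {A B : Finset (Fin N)} (h : A ⊆ B) :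
    R.serveMean k A ≤ R.serveMean k B := by
  unfold serveMean
  gcongr
  intro i _ _
  linarith [R.one_le_inv_r i, R.waitMean_nonneg]

theorem serveVar_mono (k : Fin N) {A B : Finset (Fin N)} (h : A ⊆ B) :
    R.serveVar k A ≤ R.serveVar k B := by
  unfold serveVar
  gcongr
  exact fun i _ _ => add_nonneg (R.serviceVar_nonneg i) R.waitVar_nonneg

theorem one_le_serveMean (k : Fin N) (A : Finset (Fin N)) : 1 ≤ R.serveMean k A := by
  refine le_trans ?_ (R.serveMean_mono k (Finset.empty_subset A))
  simpa [serveMean] using R.one_le_inv_r k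

theorem serveVar_nonneg (k : Fin N) (A : Finset (Fin N)) : 0 ≤ R.serveVar k A := by
  refine le_trans ?_ (R.serveVar_mono k (Finset.empty_subset A))
  simpa [serveVar] using R.serviceVar_nonneg k

theorem one_le_remMean (k : Fin N) (A : Finset (Fin N)) (m : Machine N) :
    1 ≤ R.remMean k A m := by
  have h1 := R.freeMean_nonneg
  have h2 := R.one_le_serveMean k A
  have h3 : 0 ≤ 1 / R.q := one_div_nonneg.2 R.q_pos.le
  cases m <;> simp only [remMean]
  · linarith
  · linarith
  · split_ifs <;> exact R.one_le_serveMean _ _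

theorem remVar_nonneg (k : Fin N) (A : Finset (Fin N)) (m : Machine N) :
    0 ≤ R.remVar k A m := by
  have h1 := R.freeVar_nonneg
  have h2 := R.serveVar_nonneg k A
  have h3 : 0 ≤ (1 - R.q) / R.q ^ 2 := div_nonneg (sub_nonneg.2 R.q_le) (sq_nonneg _)
  cases m <;> simp only [remVar]
  · linarith
  · linarith
  · split_ifs <;> exact R.serveVar_nonneg _ _

/-- Since `m ^ 2 - m` increases for `m ≥ 1`, a longer and more variable remainder costs more. -/
theorem cost_mono {θ v m m' V V' : ℝ} (hθ : 0 ≤ θ) (hv : 0 ≤ v) (hm : 1 ≤ m) (h : m ≤ m')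
    (hV : V ≤ V') : cost θ v m V ≤ cost θ v m' V' := by
  unfold cost
  nlinarith [mul_le_mul_of_nonneg_left h hv, mul_le_mul_of_nonneg_left h hθ,
    mul_nonneg (sub_nonneg.2 h) (by linarith : 0 ≤ m + m' - 1)]

/-! ### The potential, the Poisson equation and ties. -/

/-- The users of `S` other than `k` that are at least as old as `k`. -/
def ahead (S : Finset (Fin N)) (k : Fin N) (v : Fin N → ℕ) : Finset (Fin N) :=
  S.filter fun i => i ≠ k ∧ v k ≤ v i

/-- Some other user of `S` has the age of `k`. -/
def Tie (S : Finset (Fin N)) (k : Fin N) (v : Fin N → ℕ) : Prop :=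
  ∃ i ∈ S, i ≠ k ∧ v i = v k

variable {S : Finset (Fin N)} {k : Fin N} {v : Fin N → ℕ}

theorem ahead_adv : ahead S k (adv v) = ahead S k v := by
  simp [ahead, adv]

/-- The served user gets age 1 while `k` reaches at least 2; all other comparisons are unchanged. -/
theorem ahead_reset {i : Fin N} (hi : i ≠ k) (hv : 1 ≤ v k) :
    ahead S k (reset i v) = (ahead S k v).erase i := by
  ext j
  by_cases hj : j = i
  · simp [ahead, reset, hj, hi.symm]; omega
  · simp [ahead, reset, hj, hi.symm]

theorem ahead_reset_self : ahead S k (reset k v) = S.erase k := by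
  ext j
  by_cases hj : j = k
  · simp [ahead, hj]
  · simp [ahead, reset, hj]

theorem tie_adv : Tie S k (adv v) ↔ Tie S k v := by
  simp [Tie, adv]

/-- Together with `tie_adv` and `not_tie_reset_self`: no slot creates a tie, and a completion for
`k` destroys every tie. -/
theorem Tie.of_reset {i : Fin N} (hi : i ≠ k) (hv : 1 ≤ v k) (h : Tie S k (reset i v)) :
    Tie S k v := by
  obtain ⟨j, hj, hjk, e⟩ := h
  refine ⟨j, hj, hjk, ?_⟩
  simp only [reset, if_neg hi.symm] at e
  split_ifs at e <;> omega

theorem not_tie_reset_self (hv : ∀ i, 1 ≤ v i) : ¬ Tie S k (reset k v) := by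
  rintro ⟨j, -, hjk, e⟩
  have := hv j
  simp [reset, hjk] at e
  omega

/-- The expected cost `∑ (age + θ)` until the next completion of a job of user `k`. -/
noncomputable def potential (S : Finset (Fin N)) (k : Fin N) (θ : ℝ) (x : Config N) : ℝ :=
  cost θ (x.2 k) (R.remMean k (ahead S k x.2) x.1) (R.remVar k (ahead S k x.2) x.1)

/-- A geometric service of `i`, then the wait, then the users ahead other than `i`. Membership of
`i` in `ahead` is not needed: the running job may belong to a younger user or to one outside `S`. -/
theorem serve_potential_of_ne (θ : ℝ) {i : Fin N} (hi : i ≠ k) (hv : 1 ≤ v k) :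
    R.serve (R.potential S k θ) i v = R.potential S k θ (.ext i, v) - v k - θ := by
  have e1 : R.serveMean k (insert i (ahead S k v))
      = 1 / R.r i + (R.waitMean + R.serveMean k ((ahead S k v).erase i)) := by
    rw [show insert i (ahead S k v) = insert i ((ahead S k v).erase i) by grind]
    unfold serveMean
    rw [Finset.sum_insert (Finset.notMem_erase _ _)]
    ring
  have e2 : R.serveVar k (insert i (ahead S k v))
      = (1 - R.r i) / R.r i ^ 2 + (R.waitVar + R.serveVar k ((ahead S k v).erase i)) := by
    rw [show insert i (ahead S k v) = insert i ((ahead S k v).erase i) by grind]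
    unfold serveVar
    rw [Finset.sum_insert (Finset.notMem_erase _ _)]
    ring
  simp only [serve, potential, ahead_adv, ahead_reset hi hv, remMean, remVar, if_neg hi, e1, e2]
  have e3 : reset i v k = v k + 1 := by simp [reset, hi.symm]
  rw [e3, R.cost_wait]
  simp only [adv]
  push_cast
  exact cost_geometric (R.r_pos i).ne' _ _ _ _

/-- The cost ends with the service of `k`, so what follows the completion appears as a separate
term, with `F` free there. -/
theorem serve_ext_self (F : Config N → ℝ) (θ : ℝ)
    (hF : F (.ext k, adv v) = R.potential S k θ (.ext k, adv v)) :
    R.serve F k v = R.potential S k θ (.ext k, v) - v k - θ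
      + R.r k * (R.s * F (.busy, reset k v) + (1 - R.s) * F (.free, reset k v)) := by
  have h := cost_geometric (R.r_pos k).ne' θ (v k) 0 0
  simp only [cost, add_zero] at h
  simp only [serve, hF, potential, remMean, remVar, if_true, serveMean, serveVar,
    Finset.sum_empty, add_zero, cost, adv]
  push_cast
  linarith

theorem potential_ext_of_mem (θ : ℝ) {i : Fin N} (h : i ∈ ahead S k v) :
    R.potential S k θ (.ext i, v)
      = cost θ (v k) (R.serveMean k (ahead S k v)) (R.serveVar k (ahead S k v)) := by
  have hi : i ≠ k := (Finset.mem_filter.1 h).2.1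
  simp only [potential, remMean, remVar, if_neg hi, Finset.insert_eq_of_mem h]

theorem potential_ext_self (θ : ℝ) :
    R.potential S k θ (.ext k, v) = cost θ (v k) (R.serveMean k ∅) (R.serveVar k ∅) := by
  simp [potential, remMean, remVar]

theorem sel_mem_ahead {sel : (Fin N → ℕ) → Fin N} (hsel : IsMaxAge S sel) (hk : k ∈ S)
    (h : sel v ≠ k) : sel v ∈ ahead S k v :=
  Finset.mem_filter.2 ⟨(hsel v).1, h, (hsel v).2 k hk⟩

theorem ahead_eq_empty {sel : (Fin N → ℕ) → Fin N} (hsel : IsMaxAge S sel)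
    (h : sel v = k) (hv : ¬ Tie S k v) : ahead S k v = ∅ := by
  refine Finset.filter_eq_empty_iff.2 fun i hi hh => hv ⟨i, hi, hh.1, ?_⟩
  have := (hsel v).2 i hi
  rw [h] at this
  omega

theorem kernel_busy_potential (sel : (Fin N → ℕ) → Fin N) (θ : ℝ) :
    R.kernel sel (R.potential S k θ) (.busy, v) = R.potential S k θ (.busy, v) - v k - θ := by
  have h := cost_geometric R.q_pos.ne' θ (v k) (R.freeMean + R.serveMean k (ahead S k v))
    (R.freeVar + R.serveVar k (ahead S k v))
  simp only [kernel, potential, ahead_adv, remMean, remVar, adv]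
  push_cast
  linarith

/-- Isolates the defect of the Poisson equation at a free machine: it compares the user actually
scheduled with the assumption that all of `ahead` precede `k`. -/
theorem kernel_free_potential (sel : (Fin N → ℕ) → Fin N) (θ : ℝ) :
    R.kernel sel (R.potential S k θ) (.free, v) = R.potential S k θ (.free, v) - v k - θ
      + R.μ * (R.serve (R.potential S k θ) (sel v) v
        - (cost θ (v k) (R.serveMean k (ahead S k v)) (R.serveVar k (ahead S k v)) - v k - θ)) := by
  have h := R.cost_free θ (v k) (R.serveMean k (ahead S k v)) (R.serveVar k (ahead S k v))
  simp only [kernel, potential, ahead_adv, remMean, remVar, adv]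
  push_cast
  linarith

/-- Poisson equation off ties. -/
theorem kernel_potential {sel : (Fin N → ℕ) → Fin N} (hsel : IsMaxAge S sel) (hk : k ∈ S) {θ : ℝ}
    (hθ : cost θ 1 (R.waitMean + R.serveMean k (S.erase k))
      (R.waitVar + R.serveVar k (S.erase k)) = 0)
    (hv : 1 ≤ v k) (ht : ¬ Tie S k v) (m : Machine N) :
    R.kernel sel (R.potential S k θ) (m, v) = R.potential S k θ (m, v) - v k - θ := by
  have hs : ∀ i, R.serve (R.potential S k θ) i v = R.potential S k θ (.ext i, v) - v k - θ := by
    intro i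
    by_cases hi : i = k
    · subst hi
      rw [R.serve_ext_self _ θ rfl]
      -- After a completion for `i = k`, all other users of `S` are ahead and a full cycle starts at
      -- age 1; its cost vanishes by the choice of `θ`.
      have := R.cost_wait θ 1 (R.serveMean i (S.erase i)) (R.serveVar i (S.erase i))
      have e : reset i v i = 1 := by simp [reset]
      simp only [potential, ahead_reset_self, remMean, remVar, e, Nat.cast_one]
      rw [this, hθ]
      ring
    · exact R.serve_potential_of_ne θ hi hv
  cases m with
  | busy => exact R.kernel_busy_potential sel θ
  | ext i => exact hs i
  | free =>
    rw [R.kernel_free_potential, hs]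
    by_cases h : sel v = k
    · rw [h, R.potential_ext_self, ahead_eq_empty hsel h ht]; ring
    · rw [R.potential_ext_of_mem θ (sel_mem_ahead hsel hk h)]; ring

/-- Drift inequality, ties included. -/
theorem kernel_le_potential {sel : (Fin N → ℕ) → Fin N} (hsel : IsMaxAge S sel) (hk : k ∈ S)
    {θ c : ℝ} (hθ : 0 ≤ θ) (hc : 0 ≤ c) (hv : 1 ≤ v k) {F : Config N → ℝ}
    (h1 : ∀ m, F (m, adv v) ≤ R.potential S k θ (m, adv v))
    (h2 : ∀ m i, i ≠ k → F (m, reset i v) ≤ R.potential S k θ (m, reset i v))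
    (h3 : ∀ m, F (m, reset k v) ≤ c) (m : Machine N) :
    R.kernel sel F (m, v) ≤ R.potential S k θ (m, v) - v k - θ + c := by
  have hs : ∀ i, R.serve F i v ≤ R.potential S k θ (.ext i, v) - v k - θ + c := by
    intro i
    by_cases hi : i = k
    · subst hi
      -- The test for age 1 separates the two outcomes of the service: without completion the age is
      -- at least 2.
      have hle : R.serve F i v
          ≤ R.serve (fun x => if x.2 i = 1 then c else R.potential S i θ x) i v := by
        refine R.serve_mono ?_ fun m => ?_
        · have : ¬ adv v i = 1 := by simp only [adv]; omega
          simpa [this] using h1 _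
        · have : reset i v i = 1 := by simp [reset]
          simpa [this] using h3 _
      refine hle.trans ?_
      rw [R.serve_ext_self (S := S) _ θ (if_neg (by simp only [adv]; omega))]
      have e : reset i v i = 1 := by simp [reset]
      simp only [e, if_true]
      nlinarith [R.r_le i, mul_nonneg hc (sub_nonneg.2 (R.r_le i))]
    · have := R.serve_potential_of_ne (S := S) θ hi hv
      have := R.serve_mono (h1 (.ext i)) fun m => h2 m i hi
      linarith
  have h0 : R.serve F (sel v) v
      ≤ cost θ (v k) (R.serveMean k (ahead S k v)) (R.serveVar k (ahead S k v)) - v k - θ + c := by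
    refine (hs _).trans ?_
    -- In a tie `k` may be chosen before others in `ahead`; this only shortens the remaining time,
    -- and `cost_mono` applies.
    by_cases h : sel v = k
    · rw [h, R.potential_ext_self]
      have := cost_mono (v := (v k : ℝ)) hθ (Nat.cast_nonneg _) (R.one_le_serveMean k ∅)
        (R.serveMean_mono k (Finset.empty_subset (ahead S k v)))
        (R.serveVar_mono k (Finset.empty_subset (ahead S k v)))
      linarith
    · rw [R.potential_ext_of_mem θ (sel_mem_ahead hsel hk h)]
  have a1 := R.q_pos.le
  have a2 := sub_nonneg.2 R.q_le
  have a3 := R.μ_pos.le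
  have a4 := sub_nonneg.2 R.μ_le
  have b1 := mul_le_mul_of_nonneg_left (h1 .free) a1
  have b2 := mul_le_mul_of_nonneg_left (h1 .busy) a2
  have b3 := mul_le_mul_of_nonneg_left (h1 .busy) a1
  have b4 := mul_le_mul_of_nonneg_left (h1 .free) a2
  cases m with
  | busy =>
    have := R.kernel_busy_potential (S := S) (k := k) (v := v) sel θ
    simp only [kernel] at this ⊢
    linarith
  | ext i => exact hs i
  | free =>
    have := R.kernel_free_potential (S := S) (k := k) (v := v) sel θ
    have b5 := mul_le_mul_of_nonneg_left (add_le_add b3 b4) a4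
    have b6 := mul_le_mul_of_nonneg_left h0 a3
    have b7 := mul_le_mul_of_nonneg_right R.μ_le hc
    simp only [kernel] at this ⊢
    linarith

end Rates
end JobAge

/-! ### From the coins to powers of the transition operator. -/

namespace JobAge

instance (N : ℕ) : Finite (Coin N) :=
  Finite.of_injective (β := Fin 3 ⊕ Fin N)
    (fun | .sample => .inl 0 | .flip => .inl 1 | .release => .inl 2 | .service i => .inr i) <| by
    intro x y h
    cases x <;> cases y <;> simp_all

instance (N : ℕ) : Finite (Machine N) :=
  Finite.of_injective (β := Fin 2 ⊕ Fin N)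
    (fun | .busy => .inl 0 | .free => .inl 1 | .ext i => .inr i) <| by
    intro x y h
    cases x <;> cases y <;> simp_all

instance (N : ℕ) : MeasurableSpace (Machine N) := ⊤

/-- The machine after the action of the server when the queues are non-empty. -/
def grant {N : ℕ} (sel : (Fin N → ℕ) → Fin N) (sampled : Bool) (x : Config N) : Machine N :=
  match x.1 with
  | .busy => .busy
  | .free => if sampled then .ext (sel x.2) else .free
  | .ext i => .ext i

/-- One slot of the chain of configurations. -/
noncomputable def configStep {N : ℕ} (sel : (Fin N → ℕ) → Fin N) (c : Coin N → Bool)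
    (x : Config N) : Config N :=
  open Classical in
  (nextMachine c (grant sel (c .sample) x),
    fun i => if Completes c (grant sel (c .sample) x) i then 1 else x.2 i + 1)

/-- The chain of configurations. -/
noncomputable def configPath {Ω : Type*} {N : ℕ} (sel : (Fin N → ℕ) → Fin N)
    (ξ : ℕ → Coin N → Ω → Bool) (x : Config N) : ℕ → Ω → Config N
  | 0, _ => x
  | t + 1, ω => configStep sel (fun c => ξ t c ω) (configPath sel ξ x t ω)

/-- With non-empty queues, machine and ages follow the chain of configurations. -/
theorem path_eq_configPath {Ω : Type*} {N : ℕ} {S : Finset (Fin N)} {sel : (Fin N → ℕ) → Fin N}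
    (hsel : IsMaxAge S sel) (ξ : ℕ → Coin N → Ω → Bool) (a : ℕ → Fin N → Ω → ℕ) (x₀ : State N)
    (ω : Ω) (h : ∀ t, ∀ i ∈ S, (path sel ξ a x₀ t ω).queue i ≠ 0) (t : ℕ) :
    ((path sel ξ a x₀ t ω).machine, (path sel ξ a x₀ t ω).age)
      = configPath sel ξ (x₀.machine, x₀.age) t ω := by
  induction t with
  | zero => rfl
  | succ t ih =>
    have hg : assign sel (ξ t .sample ω) (path sel ξ a x₀ t ω)
        = grant sel (ξ t .sample ω) (configPath sel ξ (x₀.machine, x₀.age) t ω) := by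
      rw [← ih]
      have := h t _ (hsel (path sel ξ a x₀ t ω).age).1
      simp only [assign, grant]
      cases (path sel ξ a x₀ t ω).machine <;> simp [this]
    rw [← ih] at hg
    simp only [path, step, configPath, configStep]
    rw [← ih, hg]

/-- The configuration in slot `t` is a function of the coins of the earlier slots. -/
theorem measurable_configPath {Ω : Type*} {N : ℕ} (sel : (Fin N → ℕ) → Fin N)
    (ξ : ℕ → Coin N → Ω → Bool) (x : Config N) (t : ℕ) :
    Measurable[⨆ p ∈ {p : ℕ × Coin N | p.1 < t}, MeasurableSpace.comap (ξ p.1 p.2) inferInstance]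
      (configPath sel ξ x t) := by
  induction t with
  | zero => exact @measurable_const _ _ _ (_) x
  | succ t ih =>
    have h1 := ih.mono (biSup_mono fun p (hp : p.1 < t) => (Nat.lt_succ_of_lt hp : p.1 < t + 1))
      le_rfl
    have h2 : ∀ c, Measurable[⨆ p ∈ {p : ℕ × Coin N | p.1 < t + 1},
        MeasurableSpace.comap (ξ p.1 p.2) inferInstance] (ξ t c) := fun c =>
      (comap_measurable (ξ t c)).mono
        (le_iSup₂_of_le (t, c) (Nat.lt_succ_self t) le_rfl) le_rfl
    exact (measurable_of_countable fun y : (Coin N → Bool) × Config N =>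
      configStep sel y.1 y.2).comp (@Measurable.prodMk _ _ _ _ _ (_) _ _
        (@measurable_pi_lambda _ _ _ (_) _ _ h2) h1)

variable {Ω : Type*} [MeasurableSpace Ω] {P : Measure Ω} {N : ℕ}

/-- Conditioning on one of finitely many independent coins. -/
theorem lintegral_ite_coin [IsProbabilityMeasure P] {ι : Type*} [Finite ι] {η : ι → Ω → Bool}
    (hmeas : ∀ c, Measurable (η c)) (hindep : iIndepFun η P) {a : ι} {p : ℝ}
    (hp0 : 0 ≤ p) (ha : P {ω | η a ω = true} = ENNReal.ofReal p)
    {G H : (ι → Bool) → ℝ≥0∞}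
    (hG : ∀ x y : ι → Bool, (∀ c, c ≠ a → x c = y c) → G x = G y)
    (hH : ∀ x y : ι → Bool, (∀ c, c ≠ a → x c = y c) → H x = H y) :
    ∫⁻ ω, (if η a ω then G (fun c => η c ω) else H (fun c => η c ω)) ∂P
      = ENNReal.ofReal p * ∫⁻ ω, G (fun c => η c ω) ∂P
        + ENNReal.ofReal (1 - p) * ∫⁻ ω, H (fun c => η c ω) ∂P := by
  classical
  have := Fintype.ofFinite ι
  have hm : ∀ G : (ι → Bool) → ℝ≥0∞, Measurable fun ω => G (fun c => η c ω) := fun G =>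
    (measurable_of_countable G).comp (measurable_pi_lambda _ hmeas)
  have hm' : ∀ f : Bool → ℝ≥0∞, Measurable fun ω => f (η a ω) := fun f =>
    (measurable_of_countable f).comp (hmeas a)
  have key : ∀ (f : Bool → ℝ≥0∞) (G : (ι → Bool) → ℝ≥0∞),
      (∀ x y : ι → Bool, (∀ c, c ≠ a → x c = y c) → G x = G y) →
      ∫⁻ ω, f (η a ω) * G (fun c => η c ω) ∂P
        = (∫⁻ ω, f (η a ω) ∂P) * ∫⁻ ω, G (fun c => η c ω) ∂P := by
    intro f G hG
    have h1 := hindep.indepFun_finset {a} {a}ᶜ disjoint_compl_right hmeas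
    have h2 := h1.comp
      (measurable_of_countable fun y : (({a} : Finset ι) → Bool) =>
        f (y ⟨a, Finset.mem_singleton_self a⟩))
      -- The value `true` at coordinate `a` is a dummy, as `G` ignores that coordinate.
      (measurable_of_countable fun y : (({a}ᶜ : Finset ι) → Bool) =>
        G fun c => if h : c ∈ ({a}ᶜ : Finset ι) then y ⟨c, h⟩ else true)
    have h3 : ((fun y : (({a}ᶜ : Finset ι) → Bool) =>
        G fun c => if h : c ∈ ({a}ᶜ : Finset ι) then y ⟨c, h⟩ else true) ∘
          fun ω (i : ({a}ᶜ : Finset ι)) => η i ω) = fun ω => G (fun c => η c ω) := by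
      ext ω
      refine hG _ _ fun c hc => ?_
      simp [hc]
    rw [h3] at h2
    exact lintegral_mul_eq_lintegral_mul_lintegral_of_indepFun (hm' f) (hm G) h2
  have hs : MeasurableSet {ω | η a ω = true} := hmeas a (measurableSet_singleton true)
  have e1 : ∫⁻ ω, (if η a ω then 1 else 0) ∂P = ENNReal.ofReal p := by
    rw [← ha, ← lintegral_indicator_one hs]
    refine lintegral_congr fun ω => ?_
    by_cases h : η a ω <;> simp [h]
  have e2 : ∫⁻ ω, (if η a ω then 0 else 1) ∂P = ENNReal.ofReal (1 - p) := by
    rw [ENNReal.ofReal_sub _ hp0, ← ha, ENNReal.ofReal_one, ← prob_compl_eq_one_sub hs,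
      ← lintegral_indicator_one hs.compl]
    refine lintegral_congr fun ω => ?_
    by_cases h : η a ω <;> simp [h]
  calc _ = ∫⁻ ω, ((if η a ω then 1 else 0) * G (fun c => η c ω)
        + (if η a ω then 0 else 1) * H (fun c => η c ω)) ∂P := by
        refine lintegral_congr fun ω => ?_
        by_cases h : η a ω <;> simp [h]
    _ = _ := by
        rw [lintegral_add_left, key (fun b => if b then 1 else 0) G hG, key (fun b => if b then 0 else 1) H hH, e1, e2]
        exact (hm' fun b => if b then 1 else 0).mul (hm G)

theorem configStep_busy (sel : (Fin N → ℕ) → Fin N) (c : Coin N → Bool) (v : Fin N → ℕ) :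
    configStep sel c (.busy, v) = (if c .flip then .free else .busy, adv v) := by
  simp [configStep, grant, nextMachine, Completes]
  rfl

theorem configStep_ext (sel : (Fin N → ℕ) → Fin N) (c : Coin N → Bool) (i : Fin N)
    (v : Fin N → ℕ) :
    configStep sel c (.ext i, v)
      = if c (.service i) then (if c .release then .busy else .free, reset i v)
        else (.ext i, adv v) := by
  by_cases h : c (.service i)
  · simp only [configStep, grant, nextMachine, Completes, h, if_true, Prod.mk.injEq, true_and]
    ext j
    by_cases hj : j = i
    · simp [reset, hj, h]
    · simp [reset, hj, Ne.symm hj]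
  · simp only [configStep, grant, nextMachine, h]
    refine Prod.ext rfl (funext fun j => ?_)
    have : ¬ (Machine.ext i = Machine.ext j ∧ c (.service j) = true) := by
      rintro ⟨e, h'⟩
      cases e
      exact h h'
    exact if_neg this

/-- A sampled free machine behaves in this slot as if it were already executing the scheduled job.
-/
theorem configStep_free (sel : (Fin N → ℕ) → Fin N) (c : Coin N → Bool) (v : Fin N → ℕ) :
    configStep sel c (.free, v)
      = if c .sample then configStep sel c (.ext (sel v), v)
        else (if c .flip then .busy else .free, adv v) := by
  by_cases h : c .sample
  · rw [if_pos h]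
    unfold configStep
    rw [show grant sel (c .sample) (.free, v) = grant sel (c .sample) (.ext (sel v), v) by
      simp [grant, h]]
  · rw [if_neg h]
    unfold configStep
    rw [show grant sel (c .sample) (.free, v) = .free by simp [grant, h]]
    simp [nextMachine, Completes]
    rfl

namespace Rates

variable (R : Rates N)

theorem kernel_nonneg (sel : (Fin N → ℕ) → Fin N) {F : Config N → ℝ} (hF : ∀ x, 0 ≤ F x)
    (x : Config N) : 0 ≤ R.kernel sel F x := by
  have := R.kernel_mono sel (F := fun _ => 0) (G := F) (v := x.2) (fun _ => hF _)
    (fun _ _ => hF _) x.1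
  rwa [R.kernel_const] at this

theorem serve_nonneg {F : Config N → ℝ} (hF : ∀ x, 0 ≤ F x) (i : Fin N) (v : Fin N → ℕ) :
    0 ≤ R.serve F i v := R.kernel_nonneg (fun _ => i) hF (.ext i, v)

theorem ofReal_mix {p x y : ℝ} (hp0 : 0 ≤ p) (hp : p ≤ 1) (hx : 0 ≤ x) (hy : 0 ≤ y) :
    ENNReal.ofReal p * ENNReal.ofReal x + ENNReal.ofReal (1 - p) * ENNReal.ofReal y
      = ENNReal.ofReal (p * x + (1 - p) * y) := by
  have := sub_nonneg.2 hp
  rw [ENNReal.ofReal_add (by positivity) (by positivity), ENNReal.ofReal_mul hp0,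
    ENNReal.ofReal_mul this]

/-- The transition operator is the expectation over the coins of one slot. -/
theorem lintegral_configStep [IsProbabilityMeasure P] {η : Coin N → Ω → Bool}
    (hmeas : ∀ c, Measurable (η c)) (hindep : iIndepFun η P)
    (hlaw : ∀ c, P {ω | η c ω = true} = ENNReal.ofReal (Coin.prob R.μ R.s R.q R.r c))
    (sel : (Fin N → ℕ) → Fin N) {F : Config N → ℝ} (hF : ∀ x, 0 ≤ F x) (x : Config N) :
    ∫⁻ ω, ENNReal.ofReal (F (configStep sel (fun c => η c ω) x)) ∂P
      = ENNReal.ofReal (R.kernel sel F x) := by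
  have hflip : ∀ (m m' : Machine N) (v : Fin N → ℕ),
      ∫⁻ ω, ENNReal.ofReal (F (if η .flip ω then m else m', v)) ∂P
        = ENNReal.ofReal (R.q * F (m, v) + (1 - R.q) * F (m', v)) := by
    intro m m' v
    have := lintegral_ite_coin hmeas hindep R.q_pos.le (hlaw .flip)
      (G := fun _ => ENNReal.ofReal (F (m, v))) (H := fun _ => ENNReal.ofReal (F (m', v)))
      (fun _ _ _ => rfl) (fun _ _ _ => rfl)
    rw [lintegral_const, lintegral_const, measure_univ, mul_one, mul_one,
      ofReal_mix R.q_pos.le R.q_le (hF _) (hF _)] at this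
    rw [← this]
    refine lintegral_congr fun ω => ?_
    split_ifs <;> rfl
  have hrel : ∀ (m m' : Machine N) (v : Fin N → ℕ),
      ∫⁻ ω, ENNReal.ofReal (F (if η .release ω then m else m', v)) ∂P
        = ENNReal.ofReal (R.s * F (m, v) + (1 - R.s) * F (m', v)) := by
    intro m m' v
    have := lintegral_ite_coin hmeas hindep R.s_pos.le (hlaw .release)
      (G := fun _ => ENNReal.ofReal (F (m, v))) (H := fun _ => ENNReal.ofReal (F (m', v)))
      (fun _ _ _ => rfl) (fun _ _ _ => rfl)
    rw [lintegral_const, lintegral_const, measure_univ, mul_one, mul_one,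
      ofReal_mix R.s_pos.le R.s_le (hF _) (hF _)] at this
    rw [← this]
    refine lintegral_congr fun ω => ?_
    split_ifs <;> rfl
  have hs0 := R.s_pos.le
  have hs1 := sub_nonneg.2 R.s_le
  have hq0 := R.q_pos.le
  have hq1 := sub_nonneg.2 R.q_le
  have hserve : ∀ (i : Fin N) (v : Fin N → ℕ),
      ∫⁻ ω, ENNReal.ofReal (F (configStep sel (fun c => η c ω) (.ext i, v))) ∂P
        = ENNReal.ofReal (R.serve F i v) := by
    intro i v
    have := lintegral_ite_coin hmeas hindep (R.r_pos i).le (hlaw (.service i))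
      (G := fun c => ENNReal.ofReal (F (if c .release then .busy else .free, reset i v)))
      (H := fun _ => ENNReal.ofReal (F (.ext i, adv v)))
      (fun x y h => by rw [h .release (by simp)]) (fun _ _ _ => rfl)
    rw [lintegral_const, measure_univ, mul_one, hrel, ofReal_mix (R.r_pos i).le (R.r_le i)
      (add_nonneg (mul_nonneg hs0 (hF _)) (mul_nonneg hs1 (hF _))) (hF _)] at this
    rw [serve, add_comm, ← this]
    refine lintegral_congr fun ω => ?_
    rw [configStep_ext]
    split_ifs <;> rfl
  obtain ⟨m, v⟩ := x
  cases m with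
  | busy => simp only [configStep_busy, kernel]; exact hflip _ _ _
  | ext i => exact hserve i v
  | free =>
    have := lintegral_ite_coin hmeas hindep R.μ_pos.le (hlaw .sample)
      (G := fun c => ENNReal.ofReal (F (configStep sel c (.ext (sel v), v))))
      (H := fun c => ENNReal.ofReal (F (if c .flip then .busy else .free, adv v)))
      -- Once the job is assigned, the slot uses only the service and release coins.
      (fun x y h => by simp only [configStep_ext, h .release (by simp), h (.service _) (by simp)])
      (fun x y h => by rw [h .flip (by simp)])
    rw [hserve, hflip, ofReal_mix R.μ_pos.le R.μ_le (R.serve_nonneg hF _ _)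
      (add_nonneg (mul_nonneg hq0 (hF _)) (mul_nonneg hq1 (hF _)))] at this
    simp only [kernel]
    rw [add_comm, ← this]
    refine lintegral_congr fun ω => ?_
    rw [configStep_free]
    split_ifs <;> rfl

end Rates

/-- The configuration depends only on the coins of earlier slots, a disjoint family. -/
theorem indepFun_configPath {ξ : ℕ → Coin N → Ω → Bool}
    (hmeas : ∀ t c, Measurable (ξ t c))
    (hindep : iIndepFun (fun p : ℕ × Coin N => ξ p.1 p.2) P)
    (sel : (Fin N → ℕ) → Fin N) (x : Config N) (t : ℕ) :
    IndepFun (configPath sel ξ x t) (fun ω c => ξ t c ω) P := by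
  have h := indep_iSup_of_disjoint (fun p : ℕ × Coin N => (hmeas p.1 p.2).comap_le) hindep
    (S := {p | p.1 < t}) (T := {p | p.1 = t})
    (Set.disjoint_left.2 fun p (h1 : p.1 < t) (h2 : p.1 = t) => by omega)
  refine indep_of_indep_of_le_left (indep_of_indep_of_le_right h ?_) ?_
  · refine Measurable.comap_le (m₁ := _) (@measurable_pi_lambda _ _ _ (_) _ _ fun c => ?_)
    exact (comap_measurable (ξ t c)).mono (le_iSup₂_of_le (t, c) rfl le_rfl) le_rfl
  · exact (measurable_configPath sel ξ x t).comap_le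

/-- Markov property: integrating out the coins of the last slot replaces `F` by its image under the
kernel, hence the induction over all `F`. -/
theorem Rates.lintegral_configPath [IsProbabilityMeasure P] (R : Rates N) {ξ : ℕ → Coin N → Ω → Bool}
    (hmeas : ∀ t c, Measurable (ξ t c))
    (hindep : iIndepFun (fun p : ℕ × Coin N => ξ p.1 p.2) P)
    (hlaw : ∀ t c, P {ω | ξ t c ω = true} = ENNReal.ofReal (Coin.prob R.μ R.s R.q R.r c))
    (sel : (Fin N → ℕ) → Fin N) (x : Config N) (t : ℕ) {F : Config N → ℝ} (hF : ∀ x, 0 ≤ F x) :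
    ∫⁻ ω, ENNReal.ofReal (F (configPath sel ξ x t ω)) ∂P
      = ENNReal.ofReal (R.expect sel x t F) := by
  induction t generalizing F with
  | zero => simp [configPath]
  | succ t ih =>
    rw [R.expect_succ, ← ih (R.kernel_nonneg sel hF)]
    have hc : Measurable fun ω c => ξ t c ω := measurable_pi_lambda _ (hmeas t)
    have hx : Measurable (configPath sel ξ x t) :=
      (measurable_configPath sel ξ x t).mono
        (iSup₂_le fun p _ => (hmeas p.1 p.2).comap_le) le_rfl
    have hprod := (indepFun_configPath hmeas hindep sel x t).map_prod_eq_prod_map_map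
      hx.aemeasurable hc.aemeasurable
    have hg : Measurable fun y : Config N × (Coin N → Bool) =>
      ENNReal.ofReal (F (configStep sel y.2 y.1)) := measurable_of_countable _
    have := Measure.isProbabilityMeasure_map (μ := P) hc.aemeasurable
    calc ∫⁻ ω, ENNReal.ofReal (F (configPath sel ξ x (t + 1) ω)) ∂P
        = ∫⁻ y, ENNReal.ofReal (F (configStep sel y.2 y.1))
            ∂(P.map fun ω => (configPath sel ξ x t ω, fun c => ξ t c ω)) := by
          rw [lintegral_map hg (hx.prodMk hc)]
          rfl
      _ = ∫⁻ z, ∫⁻ c, ENNReal.ofReal (F (configStep sel c z)) ∂(P.map fun ω c => ξ t c ω)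
            ∂(P.map (configPath sel ξ x t)) := by
          rw [hprod, lintegral_prod _ hg.aemeasurable]
      _ = ∫⁻ z, ENNReal.ofReal (R.kernel sel F z) ∂(P.map (configPath sel ξ x t)) := by
          refine lintegral_congr fun z => ?_
          rw [lintegral_map (measurable_of_countable _) hc]
          exact R.lintegral_configStep (hmeas t)
            (hindep.precomp (g := fun c => (t, c)) fun _ _ h => (Prod.mk.inj h).2) (hlaw t) sel hF z
      _ = _ := lintegral_map (measurable_of_countable _) hx

end JobAge

/-! ### Bounded age, summable ties and the linear growth of the accumulated age. -/

namespace JobAge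

namespace Rates

variable {N : ℕ} (R : Rates N)

/-- The moments take finitely many values, so the potential is linear in the age of `k`, uniformly.
-/
theorem exists_abs_potential_le (S : Finset (Fin N)) (k : Fin N) (θ : ℝ) :
    ∃ C, 1 ≤ C ∧ ∀ x : Config N, |R.potential S k θ x| ≤ C * (1 + x.2 k) := by
  obtain ⟨B₁, h₁⟩ := (Set.finite_range fun p : Finset (Fin N) × Machine N =>
    R.remMean k p.1 p.2).bddAbove
  obtain ⟨B₂, h₂⟩ := (Set.finite_range fun p : Finset (Fin N) × Machine N =>
    R.remVar k p.1 p.2).bddAbove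
  set B := max B₁ B₂
  have hB : ∀ A m, R.remMean k A m ≤ B := fun A m =>
    (h₁ (Set.mem_range_self (A, m))).trans (le_max_left _ _)
  have hB' : ∀ A m, R.remVar k A m ≤ B := fun A m =>
    (h₂ (Set.mem_range_self (A, m))).trans (le_max_right _ _)
  have hB1 : 1 ≤ B := (R.one_le_remMean k ∅ .free).trans (hB _ _)
  refine ⟨B + (B + B ^ 2) / 2 + |θ| * B, by nlinarith [abs_nonneg θ], fun x => ?_⟩
  unfold potential cost
  set m := R.remMean k (ahead S k x.2) x.1
  set V := R.remVar k (ahead S k x.2) x.1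
  have hm : m ≤ B := hB _ _
  have hV : V ≤ B := hB' _ _
  have hm1 : 1 ≤ m := R.one_le_remMean _ _ _
  have hV0 : 0 ≤ V := R.remVar_nonneg _ _ _
  have hv : (0 : ℝ) ≤ x.2 k := Nat.cast_nonneg _
  have e1 : |(x.2 k : ℝ) * m| ≤ x.2 k * B := by
    rw [abs_of_nonneg (by positivity)]; gcongr
  have e2 : |(V + m ^ 2 - m) / 2| ≤ (B + B ^ 2) / 2 := by
    rw [abs_of_nonneg (by nlinarith)]; nlinarith
  have e3 : |θ * m| ≤ |θ| * B := by
    rw [abs_mul, abs_of_nonneg (by linarith : 0 ≤ m)]; gcongr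
  have e4 : 0 ≤ ((B + B ^ 2) / 2 + |θ| * B) * x.2 k := by positivity
  calc _ ≤ |(x.2 k : ℝ) * m| + |(V + m ^ 2 - m) / 2| + |θ * m| := abs_add_three _ _ _
    _ ≤ _ := by nlinarith

theorem age_le_potential (S : Finset (Fin N)) (k : Fin N) {θ : ℝ} (hθ : 0 ≤ θ) (x : Config N) :
    (x.2 k : ℝ) ≤ R.potential S k θ x := by
  unfold potential cost
  have hm1 := R.one_le_remMean k (ahead S k x.2) x.1
  have hV0 := R.remVar_nonneg k (ahead S k x.2) x.1
  have hv : (0 : ℝ) ≤ x.2 k := Nat.cast_nonneg _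
  nlinarith [mul_nonneg hv (sub_nonneg.2 hm1), mul_nonneg hθ (zero_le_one.trans hm1)]

theorem potential_nonneg (S : Finset (Fin N)) (k : Fin N) {θ : ℝ} (hθ : 0 ≤ θ) (x : Config N) :
    0 ≤ R.potential S k θ x :=
  (Nat.cast_nonneg _).trans (R.age_le_potential S k hθ x)

variable {S : Finset (Fin N)} {k : Fin N} {sel : (Fin N → ℕ) → Fin N}

/-- The expected age is bounded in time. -/
theorem exists_expect_age_le (hsel : IsMaxAge S sel) (hk : k ∈ S) {x : Config N}
    (hx : ∀ i, 1 ≤ x.2 i) :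
    ∃ D, ∀ t, R.expect sel x t (fun y => (y.2 k : ℝ)) ≤ D := by
  obtain ⟨C, hC, hb⟩ := R.exists_abs_potential_le S k 1
  set G := R.potential S k 1
  have hC0 : 0 < C := by linarith
  -- The drift bound gives the recursion `e ↦ (1 - 1 / C) e + 2 C`, whose fixed point is `C * (C *
  -- 2)`.
  refine ⟨max (G x) (C * (C * 2)), fun t =>
    (R.expect_mono sel hx t fun m v _ => R.age_le_potential S k zero_le_one (m, v)).trans ?_⟩
  change R.expect sel x t G ≤ _
  induction t with
  | zero => exact le_max_left _ _
  | succ t ih =>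
    rw [R.expect_succ]
    have hstep : R.expect sel x t (R.kernel sel G)
        ≤ R.expect sel x t ((1 - 1 / C) • G + fun _ => C * 2) := by
      refine R.expect_mono sel hx t fun m v hv => ?_
      have h1 := R.kernel_le_potential (v := v) hsel hk zero_le_one
        (by positivity : 0 ≤ C * 2) (hv k) (F := G) (fun _ => le_rfl) (fun _ _ _ => le_rfl)
        (fun m => by
          have := (le_abs_self _).trans (hb (m, reset k v))
          have e : reset k v k = 1 := by simp [reset]
          simp only [e, Nat.cast_one] at this
          linarith) m
      have h2 : G (m, v) / C ≤ 1 + v k := by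
        rw [div_le_iff₀ hC0, mul_comm]
        exact (le_abs_self _).trans (hb (m, v))
      simp only [Pi.add_apply, Pi.smul_apply, smul_eq_mul]
      change R.kernel sel G (m, v) ≤ G (m, v) - v k - 1 + C * 2 at h1
      have : (1 - 1 / C) * G (m, v) = G (m, v) - G (m, v) / C := by ring
      linarith
    refine hstep.trans ?_
    rw [map_add, map_smul, R.expect_const, smul_eq_mul]
    set D := max (G x) (C * (C * 2))
    have h3 : 0 ≤ 1 - 1 / C := sub_nonneg.2 ((div_le_one hC0).2 hC)
    have h4 : C * 2 ≤ 1 / C * D := by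
      rw [one_div, ← div_eq_inv_mul, le_div_iff₀ hC0, mul_comm]
      exact le_max_right _ _
    nlinarith [mul_le_mul_of_nonneg_left ih h3]

open Classical in
/-- The total expected age accumulated in slots with a tie is finite. -/
theorem exists_sum_expect_tie_le (hsel : IsMaxAge S sel) (hk : k ∈ S) {x : Config N}
    (hx : ∀ i, 1 ≤ x.2 i) :
    ∃ D, ∀ T, ∑ t ∈ Finset.range T,
      R.expect sel x t (fun y => if Tie S k y.2 then 1 + (y.2 k : ℝ) else 0) ≤ D := by
  set F : Config N → ℝ := fun y => if Tie S k y.2 then R.potential S k 1 y else 0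
  have hF : ∀ y, 0 ≤ F y := fun y => by
    simp only [F]
    split_ifs
    exacts [R.potential_nonneg S k zero_le_one y, le_rfl]
  have hF' : ∀ y, F y ≤ R.potential S k 1 y := fun y => by
    simp only [F]
    split_ifs
    exacts [le_rfl, R.potential_nonneg S k zero_le_one y]
  have hstep : ∀ m v, (∀ i, 1 ≤ v i) → R.kernel sel F (m, v)
      ≤ (F - fun y : Config N => if Tie S k y.2 then 1 + (y.2 k : ℝ) else 0) (m, v) := by
    intro m v hv
    by_cases ht : Tie S k v
    -- Here `c = 0`, since a completion for `k` ends the tie and `F` vanishes there.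
    · have := R.kernel_le_potential (v := v) hsel hk zero_le_one le_rfl (hv k) (F := F)
        (fun _ => hF' _) (fun _ _ _ => hF' _)
        (fun m => by simp [F, not_tie_reset_self hv]) m
      simp only [Pi.sub_apply, F, if_pos ht] at this ⊢
      linarith
    · have : R.kernel sel F (m, v) = R.kernel sel (fun _ => 0) (m, v) := by
        refine R.kernel_congr sel (fun m => ?_) (fun m i => ?_) m
        · simp [F, tie_adv, ht]
        · by_cases hi : i = k
          · subst hi; simp [F, not_tie_reset_self hv]
          · exact if_neg fun h => ht (Tie.of_reset hi (hv k) h)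
      rw [this, R.kernel_const]
      simp [F, ht]
  refine ⟨F x, fun T => ?_⟩
  have hsum : ∑ t ∈ Finset.range T,
      R.expect sel x t (fun y => if Tie S k y.2 then 1 + (y.2 k : ℝ) else 0)
      ≤ ∑ t ∈ Finset.range T, (R.expect sel x t F - R.expect sel x (t + 1) F) := by
    refine Finset.sum_le_sum fun t _ => ?_
    have := R.expect_mono sel hx t hstep
    rw [map_sub] at this
    rw [R.expect_succ]
    linarith
  refine hsum.trans ?_
  rw [Finset.sum_range_sub', R.expect_zero]
  have := R.expect_mono sel hx T (F := fun _ => 0) (G := F) fun _ _ _ => hF _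
  rw [R.expect_const] at this
  linarith

open Classical in
/-- The accumulated expected age grows linearly, up to a bounded error. -/
theorem exists_abs_sum_expect_sub_le (hsel : IsMaxAge S sel) (hk : k ∈ S) {x : Config N}
    (hx : ∀ i, 1 ≤ x.2 i) {Δ : ℝ}
    (hΔ : cost (-Δ) 1 (R.waitMean + R.serveMean k (S.erase k))
      (R.waitVar + R.serveVar k (S.erase k)) = 0) :
    ∃ D, ∀ T : ℕ, |∑ t ∈ Finset.range T, R.expect sel x t (fun y => (y.2 k : ℝ)) - T * Δ| ≤ D := by
  obtain ⟨C, hC, hb⟩ := R.exists_abs_potential_le S k (-Δ)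
  obtain ⟨D₁, hD₁⟩ := R.exists_expect_age_le hsel hk hx
  obtain ⟨D₂, hD₂⟩ := R.exists_sum_expect_tie_le hsel hk hx
  set A : Config N → ℝ := fun y => (y.2 k : ℝ)
  set W : Config N → ℝ := fun y => if Tie S k y.2 then 1 + (y.2 k : ℝ) else 0
  -- Off ties all successors are off ties too, so `H` solves the Poisson equation there; on ties any
  -- linear bound suffices.
  set H : Config N → ℝ := fun y => if Tie S k y.2 then 0 else R.potential S k (-Δ) y
  have hH : ∀ y, |H y| ≤ C * (1 + y.2 k) := by
    intro y
    simp only [H]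
    split_ifs
    · rw [abs_zero]; positivity
    · exact hb y
  -- On ties `H` vanishes, its image under the kernel is at most `C * (2 + v k)` in absolute value,
  -- and the age and `Δ` account for `1 + |Δ|`.
  set E : ℝ := 2 * C + 1 + |Δ|
  have hE : 0 ≤ E := by positivity
  set err : Config N → ℝ := R.kernel sel H - H + A - fun _ => Δ
  have herr : ∀ m v, (∀ i, 1 ≤ v i) → |err (m, v)| ≤ E * W (m, v) := by
    intro m v hv
    simp only [err, Pi.sub_apply, Pi.add_apply]
    by_cases ht : Tie S k v
    · have hv0 : (0 : ℝ) ≤ v k := Nat.cast_nonneg _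
      have hbd : ∀ y : Config N, y.2 k ≤ v k + 1 → |H y| ≤ C * (2 + v k) := fun y hy => by
        have : (y.2 k : ℝ) ≤ v k + 1 := by exact_mod_cast hy
        exact (hH y).trans (mul_le_mul_of_nonneg_left (by linarith) (by linarith))
      have hadv : ∀ m, |H (m, adv v)| ≤ C * (2 + v k) := fun m => hbd _ le_rfl
      have hres : ∀ m i, |H (m, reset i v)| ≤ C * (2 + v k) := fun m i => hbd _ (by
        simp only [reset]; split_ifs <;> omega)
      have h1 := R.kernel_mono sel (F := H) (G := fun _ => C * (2 + v k)) (v := v)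
        (fun m => (abs_le.1 (hadv m)).2) (fun m i => (abs_le.1 (hres m i)).2) m
      have h2 := R.kernel_mono sel (F := fun _ => -(C * (2 + v k))) (G := H) (v := v)
        (fun m => (abs_le.1 (hadv m)).1) (fun m i => (abs_le.1 (hres m i)).1) m
      rw [R.kernel_const] at h1 h2
      have h3 : H (m, v) = 0 := if_pos ht
      have h4 : W (m, v) = 1 + v k := if_pos ht
      rw [h3, h4]
      simp only [A, E]
      have h5 := neg_abs_le Δ
      have h6 := le_abs_self Δ
      have h7 : 0 ≤ |Δ| * v k := by positivity
      have h8 : 0 ≤ C * v k := by positivity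
      rw [abs_le]
      constructor <;> nlinarith
    · have h1 : R.kernel sel H (m, v) = R.kernel sel (R.potential S k (-Δ)) (m, v) := by
        refine R.kernel_congr sel (fun m => ?_) (fun m i => ?_) m
        · exact if_neg (tie_adv.not.2 ht)
        · refine if_neg ?_
          by_cases hi : i = k
          · subst hi; exact not_tie_reset_self hv
          · exact fun h => ht (Tie.of_reset hi (hv k) h)
      have h3 : H (m, v) = R.potential S k (-Δ) (m, v) := if_neg ht
      have h4 : W (m, v) = 0 := if_neg ht
      rw [h1, h3, h4, R.kernel_potential hsel hk hΔ (hv k) ht, mul_zero]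
      simp only [A, abs_nonpos_iff]
      ring
  have hsum : ∀ T : ℕ, ∑ t ∈ Finset.range T, R.expect sel x t A - T * Δ
      = H x - R.expect sel x T H + ∑ t ∈ Finset.range T, R.expect sel x t err := by
    intro T
    have e : ∀ t, R.expect sel x t err
        = R.expect sel x (t + 1) H - R.expect sel x t H + R.expect sel x t A - Δ := by
      intro t
      rw [map_sub, map_add, map_sub, R.expect_const, R.expect_succ]
    have h0 := Finset.sum_range_sub (fun t => R.expect sel x t H) T
    simp only [Finset.sum_sub_distrib, R.expect_zero] at h0
    simp only [e, Finset.sum_sub_distrib, Finset.sum_add_distrib, Finset.sum_const,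
      Finset.card_range, nsmul_eq_mul]
    linarith
  refine ⟨|H x| + C * (1 + D₁) + E * D₂, fun T => ?_⟩
  rw [hsum]
  have b1 : |R.expect sel x T H| ≤ C * (1 + D₁) := by
    have hA : R.expect sel x T (C • ((fun _ => 1) + A)) ≤ C * (1 + D₁) := by
      rw [map_smul, map_add, R.expect_const, smul_eq_mul]
      have := hD₁ T
      gcongr
    refine abs_le.2 ⟨?_, ?_⟩
    · have := R.expect_mono sel hx T (F := -(C • ((fun _ => 1) + A))) (G := H)
        fun m v _ => (abs_le.1 (hH (m, v))).1
      rw [map_neg] at this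
      linarith
    · exact (R.expect_mono sel hx T fun m v _ => (abs_le.1 (hH (m, v))).2).trans hA
  have b2 : |∑ t ∈ Finset.range T, R.expect sel x t err| ≤ E * D₂ := by
    calc _ ≤ ∑ t ∈ Finset.range T, |R.expect sel x t err| := Finset.abs_sum_le_sum_abs _ _
      _ ≤ ∑ t ∈ Finset.range T, E * R.expect sel x t W := by
        refine Finset.sum_le_sum fun t _ => ?_
        rw [← smul_eq_mul, ← map_smul]
        refine abs_le.2 ⟨?_, ?_⟩
        · rw [← map_neg]
          exact R.expect_mono sel hx t fun m v hv => (abs_le.1 (herr m v hv)).1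
        · exact R.expect_mono sel hx t fun m v hv => (abs_le.1 (herr m v hv)).2
      _ ≤ _ := by
        rw [← Finset.mul_sum]
        exact mul_le_mul_of_nonneg_left (hD₂ T) hE
  calc _ ≤ |H x| + |R.expect sel x T H| + |∑ t ∈ Finset.range T, R.expect sel x t err| :=
        (abs_add_le _ _).trans (by gcongr; exact abs_sub _ _)
    _ ≤ _ := by gcongr

/-! ### Closed form of the average age. -/

theorem waitMean_add_one : R.waitMean + 1 = beta1 R.μ R.s R.q := by
  have := R.μ_pos.ne'
  have := R.q_pos.ne'
  unfold waitMean freeMean beta1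
  field_simp
  ring

/-- `beta1` and `beta2` are the first two moments of the wait plus one slot, and the shift leaves
the variance unchanged. -/
theorem waitVar_eq : R.waitVar = beta2 R.μ R.s R.q - beta1 R.μ R.s R.q ^ 2 := by
  have := R.μ_pos.ne'
  have := R.q_pos.ne'
  unfold waitVar freeVar freeMean beta2 beta1 alpha
  field_simp
  ring

/-- In a full cycle each user of `S` contributes one wait and one service, so `k` plays no special
role. The first slot of each service is absorbed in `beta1`. -/
theorem waitMean_add_serveMean (hk : k ∈ S) :
    R.waitMean + R.serveMean k (S.erase k)
      = S.card * beta1 R.μ R.s R.q + ∑ i ∈ S, (1 - R.r i) / R.r i := by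
  have h := Finset.add_sum_erase S (fun i => 1 / R.r i + R.waitMean) hk
  have e : ∀ i, (1 - R.r i) / R.r i = 1 / R.r i - 1 := fun i => by
    rw [sub_div, div_self (R.r_pos i).ne']
  simp only [e, Finset.sum_sub_distrib, ← R.waitMean_add_one]
  simp only [Finset.sum_add_distrib, Finset.sum_const, nsmul_eq_mul, serveMean] at h ⊢
  linarith

theorem waitVar_add_serveVar (hk : k ∈ S) :
    R.waitVar + R.serveVar k (S.erase k)
      = S.card * (beta2 R.μ R.s R.q - beta1 R.μ R.s R.q ^ 2)
        + ∑ i ∈ S, (1 - R.r i) / R.r i ^ 2 := by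
  have h := Finset.add_sum_erase S (fun i => (1 - R.r i) / R.r i ^ 2 + R.waitVar) hk
  simp only [← R.waitVar_eq]
  simp only [Finset.sum_add_distrib, Finset.sum_const, nsmul_eq_mul, serveVar] at h ⊢
  linarith

/-- Solves for `θ` the linear equation that a cycle of mean `m` and variance `V`, begun at age 1,
has zero cost; this yields the formula for `Δ`. -/
theorem cost_cycle {m : ℝ} (hm : m ≠ 0) (V : ℝ) :
    cost (-(V / (2 * m) + 1 / 2 * (m + 1))) 1 m V = 0 := by
  unfold cost
  field_simp
  ring

end Rates

theorem tendsto_div_of_abs_sub_le {u : ℕ → ℝ} {Δ D : ℝ} (h : ∀ T : ℕ, |u T - T * Δ| ≤ D) :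
    Tendsto (fun T : ℕ => u T / T) atTop (nhds Δ) := by
  have h0 : Tendsto (fun T : ℕ => (u T - T * Δ) / T) atTop (nhds 0) := by
    refine squeeze_zero_norm (fun T => ?_) (tendsto_const_div_atTop_nhds_zero_nat D)
    rw [norm_div, Real.norm_natCast]
    exact div_le_div_of_nonneg_right (h T) (Nat.cast_nonneg _)
  have h1 := h0.add_const Δ
  rw [zero_add] at h1
  refine h1.congr' ?_
  filter_upwards [eventually_gt_atTop 0] with T hT
  have : (T : ℝ) ≠ 0 := by positivity
  field_simp
  ring

end JobAge

theorem theorem3 {Ω : Type*} [MeasurableSpace Ω] (P : Measure Ω) [IsProbabilityMeasure P]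
    {N : ℕ} (S : Finset (Fin N)) (k : Fin N) (hk : k ∈ S)
    (μ s q : ℝ) (r : Fin N → ℝ)
    (hμ : 0 < μ ∧ μ ≤ 1) (hs : 0 < s ∧ s ≤ 1) (hq : 0 < q ∧ q ≤ 1)
    (hr : ∀ i, 0 < r i ∧ r i ≤ 1)
    (ξ : ℕ → JobAge.Coin N → Ω → Bool)
    (hmeas : ∀ t c, Measurable (ξ t c))
    (hindep : iIndepFun (fun p : ℕ × JobAge.Coin N => ξ p.1 p.2) P)
    (hlaw : ∀ t c, P {ω | ξ t c ω = true} = ENNReal.ofReal (JobAge.Coin.prob μ s q r c))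
    (a : ℕ → Fin N → Ω → ℕ)
    (sel : (Fin N → ℕ) → Fin N) (hsel : JobAge.IsMaxAge S sel)
    (x₀ : JobAge.State N) (hage : ∀ i, 1 ≤ x₀.age i)
    (hbacklog : ∀ᵐ ω ∂P, ∀ t, ∀ i ∈ S, (JobAge.path sel ξ a x₀ t ω).queue i ≠ 0) :
    JobAge.avgAge P (JobAge.path sel ξ a x₀) k =
      ENNReal.ofReal
        (((S.card : ℝ) * (JobAge.beta2 μ s q - JobAge.beta1 μ s q ^ 2)
              + ∑ i ∈ S, (1 - r i) / r i ^ 2)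
            / (2 * ((S.card : ℝ) * JobAge.beta1 μ s q + ∑ i ∈ S, (1 - r i) / r i))
          + 1 / 2 * ((S.card : ℝ) * JobAge.beta1 μ s q + ∑ i ∈ S, (1 - r i) / r i + 1)) := by
  let R : JobAge.Rates N := ⟨μ, s, q, r, hμ.1, hμ.2, hs.1, hs.2, hq.1, hq.2, fun i => (hr i).1,
    fun i => (hr i).2⟩
  set m : ℝ := (S.card : ℝ) * JobAge.beta1 μ s q + ∑ i ∈ S, (1 - r i) / r i
  set V : ℝ := (S.card : ℝ) * (JobAge.beta2 μ s q - JobAge.beta1 μ s q ^ 2)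
    + ∑ i ∈ S, (1 - r i) / r i ^ 2
  have hm : R.waitMean + R.serveMean k (S.erase k) = m := R.waitMean_add_serveMean hk
  have hV : R.waitVar + R.serveVar k (S.erase k) = V := R.waitVar_add_serveVar hk
  have hm0 : m ≠ 0 := by
    have := R.waitMean_nonneg
    have := R.one_le_serveMean k (S.erase k)
    linarith
  have hΔ := JobAge.Rates.cost_cycle hm0 V
  rw [← hm, ← hV] at hΔ
  obtain ⟨D, hD⟩ := R.exists_abs_sum_expect_sub_le (x := (x₀.machine, x₀.age)) hsel hk hage hΔ
  rw [hm, hV] at hD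
  have hage_t : ∀ t, ∫⁻ ω, ((JobAge.path sel ξ a x₀ t ω).age k : ℝ≥0∞) ∂P
      = ENNReal.ofReal (R.expect sel (x₀.machine, x₀.age) t fun y => (y.2 k : ℝ)) := by
    intro t
    rw [← R.lintegral_configPath hmeas hindep hlaw sel _ t fun y => Nat.cast_nonneg _]
    refine lintegral_congr_ae ?_
    filter_upwards [hbacklog] with ω hω
    rw [← JobAge.path_eq_configPath hsel ξ a x₀ ω hω t, ENNReal.ofReal_natCast]
  have hnn : ∀ t, 0 ≤ R.expect sel (x₀.machine, x₀.age) t fun y => (y.2 k : ℝ) := fun t => by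
    have := R.expect_mono sel (x := (x₀.machine, x₀.age)) hage t (F := fun _ => 0)
      (G := fun y => (y.2 k : ℝ)) fun _ _ _ => Nat.cast_nonneg _
    rwa [R.expect_const] at this
  refine Tendsto.limsup_eq
    ((ENNReal.tendsto_ofReal (JobAge.tendsto_div_of_abs_sub_le hD)).congr' ?_)
  filter_upwards [eventually_gt_atTop 0] with T hT
  simp only [hage_t]
  rw [ENNReal.ofReal_div_of_pos (by positivity), ENNReal.ofReal_natCast,
    ENNReal.ofReal_sum_of_nonneg fun t _ => hnn t]
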